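/- Let $n\ge 1$ and let $M$ be an oriented smooth Riemannian manifold of dimension $n$ without boundary, with metric $\langle\cdot,\cdot\rangle$, Riemannian volume form $\mathrm{vol}$ and Riemannian distance $\mathrm{dist}$. Let $e_1,\dots,e_{n-1}:M\to\mathbb R$ be $C^2$ functions, $e=(e_1,\dots,e_{n-1}):M\to\mathbb R^{n-1}$, $P=e^{-1}(0)$, and let $k_1,\dots,k_{n-1}>0$. Define the guiding vector field $$\chi=\bot_e-\sum_{i=1}^{n-1}k_i e_i\,\mathrm{grad}\,e_i ,$$ where $\bot_e$ is the vector field determined by $\langle\bot_e,Y\rangle=\mathrm{vol}(\mathrm{grad}\,e_1,\dots,\mathrm{grad}\,e_{n-1},Y)$ for all tangent vectors $Y$. Let $C=\{\xi\in M:\chi(\xi)=0\}$ and assume that $C=\emptyset$ or $\mathrm{dist}(C,P)>0$, and that $P$ is homeomorphic to the unit circle $\mathbb S^1$. Let $\Psi$ be the (maximal) flow of $\dot\xi=\chi(\xi)$; completeness of $\chi$ is not assumed, and $\Psi(J,\xi)$ denotes the set of the $\Psi^t(\xi)$ with $t\in J$ for which the solution is defined. Let $V\subseteq M$ be an open neighbourhood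 of $P$, $U\subseteq\mathbb R^{n-1}$ open, and $\Gamma:V\to U\times\mathbb S^1$ a $C^2$-diffeomorphism with $e|_V=\pi_U\circ\Gamma$, where $\pi_U$ is the projection to $U$ (so $U=e(V)$). Write $e_V=e|_V$. Let $R>0$ be such that the ellipsoid $E=\{x\in\mathbb R^{n-1}:\sum_i k_i x_i^2<R\}$ satisfies $\overline E\subseteq U$. Put $S=e_V^{-1}(\partial\overline E)$ and $W=M\setminus e_V^{-1}(E)$. Then: (i) the exit set $W^e=\{\xi\in W:\ \forall t>0,\ \Psi([0,t),\xi)\not\subseteq W\}$ of $W$ is equal to $S$; (ii) $e_V^{-1}(\overline E)$ and $e_V^{-1}(E)$ are forward invariant: every solution starting in one of these sets exists for all $t\ge 0$ and stays in that set; (iii) for every $\xi_0\in e_V^{-1}(\overline E)$ the trajectory $\xi(t)$ of $\dot\xi=\chi(\xi)$ with $\xi(0)=\xi_0$ exists for all $t\ge0$ and converges to $P$, that is, $\mathrm{dist}(\xi(t),P)\to 0$ as $t\to\infty$; (iv) $\{\Psi^t(\xi):t>0,\ \xi\in S\}\subseteq e_V^{-1}(E)$. -/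

import Mathlib

open Set Filter Topology Manifold Bundle
open scoped ContDiff

noncomputable section

/-! ### Solutions and flow of an autonomous differential equation on a manifold

The flow is the maximal one: completeness of the vector field is not required. -/

section Flow

variable {n : ℕ} {M : Type*} [TopologicalSpace M] [ChartedSpace (EuclideanSpace ℝ (Fin n)) M]

/-- `FlowsTo X t x y` means `Ψ^t(x) = y` for the (maximal) flow `Ψ` of `X`: some solution of
`ξ' = X(ξ)` on an open interval containing `0` and `t` has `ξ(0) = x` and `ξ(t) = y`. -/
def FlowsTo (X : (x : M) → TangentSpace (𝓡 n) x) (t : ℝ) (x y : M) : Prop :=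
  ∃ (γ : ℝ → M) (a b : ℝ), 0 ∈ Ioo a b ∧ t ∈ Ioo a b ∧ IsMIntegralCurveOn γ X (Ioo a b) ∧
    γ 0 = x ∧ γ t = y

/-- `Ψ^J(A)`, the set of all points `Ψ^t(x)` with `t ∈ J`, `x ∈ A` for which `Ψ^t(x)` is defined. -/
def flowImage (X : (x : M) → TangentSpace (𝓡 n) x) (J : Set ℝ) (A : Set M) : Set M :=
  {y | ∃ t ∈ J, ∃ x ∈ A, FlowsTo X t x y}

/-- The exit set `W^e = {x ∈ W : ∀ t > 0, Ψ([0,t), x) ⊈ W}`. -/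
def exitSet (X : (x : M) → TangentSpace (𝓡 n) x) (W : Set M) : Set M :=
  {x ∈ W | ∀ t > 0, ¬ flowImage X (Ico 0 t) {x} ⊆ W}

/-- `A` is forward invariant: solutions starting in `A` exist for all `t ≥ 0` and stay in `A`. -/
def FlowForwardInvariant (X : (x : M) → TangentSpace (𝓡 n) x) (A : Set M) : Prop :=
  ∀ x ∈ A, ∀ t ≥ 0, (∃ y, FlowsTo X t x y) ∧ ∀ y, FlowsTo X t x y → y ∈ A

/-- `ξ` is a trajectory on `[0, ∞)` with initial condition `ξ(0) = x`. -/
def IsForwardTrajectory (X : (x : M) → TangentSpace (𝓡 n) x) (x : M) (ξ : ℝ → M) : Prop :=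
  ξ 0 = x ∧ IsMIntegralCurveOn ξ X (Ici 0)

/-- An orientation of the manifold: the orientations of the tangent spaces vary continuously, i.e.
read in the tangent bundle chart at `x₀` they are constant near `x₀`. -/
def IsManifoldOrientation [IsManifold (𝓡 n) 1 M]
    (o : (x : M) → Orientation ℝ (TangentSpace (𝓡 n) x) (Fin n)) : Prop :=
  ∀ x₀ : M, ∃ o₀ : Orientation ℝ (EuclideanSpace ℝ (Fin n)) (Fin n), ∀ᶠ x in 𝓝 x₀,
    ∀ hx : x ∈ (trivializationAt (EuclideanSpace ℝ (Fin n)) (TangentSpace (𝓡 n) : M → Type _)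
        x₀).baseSet,
      Orientation.map (Fin n)
        ((trivializationAt (EuclideanSpace ℝ (Fin n)) (TangentSpace (𝓡 n) : M → Type _)
          x₀).continuousLinearEquivAt ℝ x hx).toLinearEquiv (o x) = o₀

instance instFiniteDimensionalTangent (x : M) : FiniteDimensional ℝ (TangentSpace (𝓡 n) x) :=
  inferInstanceAs (FiniteDimensional ℝ (EuclideanSpace ℝ (Fin n)))

instance instFactFinrankTangent (x : M) :
    Fact (Module.finrank ℝ (TangentSpace (𝓡 n) x) = n) :=
  ⟨(finrank_euclideanSpace_fin : Module.finrank ℝ (EuclideanSpace ℝ (Fin n)) = n)⟩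

end Flow

/-! ### The guiding vector field on an oriented Riemannian manifold of dimension `m + 1` -/

section GuidingVectorField

variable {n m : ℕ} {M : Type*} [TopologicalSpace M]

/-- The tangent vector representing a linear functional through the Riemannian metric. -/
def riesz [ChartedSpace (EuclideanSpace ℝ (Fin n)) M]
    [RiemannianBundle (fun x : M ↦ TangentSpace (𝓡 n) x)]
    (x : M) (ℓ : TangentSpace (𝓡 n) x →ₗ[ℝ] ℝ) : TangentSpace (𝓡 n) x :=
  haveI : CompleteSpace (TangentSpace (𝓡 n) x) := FiniteDimensional.complete ℝ _
  (InnerProductSpace.toDual ℝ (TangentSpace (𝓡 n) x)).symm (LinearMap.toContinuousLinearMap ℓ)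

theorem inner_riesz [ChartedSpace (EuclideanSpace ℝ (Fin n)) M]
    [RiemannianBundle (fun x : M ↦ TangentSpace (𝓡 n) x)]
    (x : M) (ℓ : TangentSpace (𝓡 n) x →ₗ[ℝ] ℝ) (Y : TangentSpace (𝓡 n) x) :
    inner ℝ (riesz x ℓ) Y = ℓ Y := by
  have : CompleteSpace (TangentSpace (𝓡 n) x) := FiniteDimensional.complete ℝ _
  simp [riesz]

/-- The Riemannian gradient of a real function `f`. -/
def riemGrad [ChartedSpace (EuclideanSpace ℝ (Fin n)) M]
    [RiemannianBundle (fun x : M ↦ TangentSpace (𝓡 n) x)]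
    (f : M → ℝ) (x : M) : TangentSpace (𝓡 n) x :=
  riesz x (mfderiv (𝓡 n) 𝓘(ℝ, ℝ) f x : TangentSpace (𝓡 n) x →L[ℝ] ℝ).toLinearMap

/-- The path-following error `e = (e₁, …, e_m)`. -/
def pathError (e : Fin m → M → ℝ) (x : M) : EuclideanSpace ℝ (Fin m) :=
  WithLp.toLp 2 (fun i ↦ e i x)

/-- The desired path `P = {x : e(x) = 0}`. -/
def desiredPath (e : Fin m → M → ℝ) : Set M := {x | ∀ i, e i x = 0}

variable [ChartedSpace (EuclideanSpace ℝ (Fin (m + 1))) M]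
  [RiemannianBundle (fun x : M ↦ TangentSpace (𝓡 (m + 1)) x)]

/-- The generalized wedge product `⊥_e` of the gradients of `e₁, …, e_m`: the vector with
`⟨⊥_e, Y⟩ = vol(grad e₁, …, grad e_m, Y)` for every tangent vector `Y`, where `vol` is the
Riemannian volume form. -/
def wedgeGrad (o : (x : M) → Orientation ℝ (TangentSpace (𝓡 (m + 1)) x) (Fin (m + 1)))
    (e : Fin m → M → ℝ) (x : M) : TangentSpace (𝓡 (m + 1)) x :=
  riesz x ((o x).volumeForm.toMultilinearMap.toLinearMap
    (Fin.snoc (α := fun _ ↦ TangentSpace (𝓡 (m + 1)) x) (fun i ↦ riemGrad (e i) x) 0)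
    (Fin.last m))

theorem inner_wedgeGrad
    (o : (x : M) → Orientation ℝ (TangentSpace (𝓡 (m + 1)) x) (Fin (m + 1)))
    (e : Fin m → M → ℝ) (x : M) (Y : TangentSpace (𝓡 (m + 1)) x) :
    inner ℝ (wedgeGrad o e x) Y = (o x).volumeForm
      (Fin.snoc (α := fun _ ↦ TangentSpace (𝓡 (m + 1)) x) (fun i ↦ riemGrad (e i) x) Y) := by
  rw [wedgeGrad, inner_riesz]
  simp [MultilinearMap.toLinearMap, Fin.update_snoc_last]

/-- The guiding vector field `χ = ⊥_e - ∑ᵢ kᵢ eᵢ grad eᵢ`. -/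
def guidingField (o : (x : M) → Orientation ℝ (TangentSpace (𝓡 (m + 1)) x) (Fin (m + 1)))
    (e : Fin m → M → ℝ) (k : Fin m → ℝ) (x : M) : TangentSpace (𝓡 (m + 1)) x :=
  wedgeGrad o e x - ∑ i, (k i * e i x) • riemGrad (e i) x

/-- The singular set `C = {x : χ(x) = 0}`. -/
def singularSet (o : (x : M) → Orientation ℝ (TangentSpace (𝓡 (m + 1)) x) (Fin (m + 1)))
    (e : Fin m → M → ℝ) (k : Fin m → ℝ) : Set M :=
  {x | guidingField o e k x = 0}

end GuidingVectorField

/-- The open ellipsoid `{y : ∑ᵢ kᵢ yᵢ² < R}`. -/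
def ellipsoid {m : ℕ} (k : Fin m → ℝ) (R : ℝ) : Set (EuclideanSpace ℝ (Fin m)) :=
  {y | ∑ i, k i * y i ^ 2 < R}

/-- `e_V⁻¹(A)`, the preimage of `A` under the restriction of the error `e` to `V`. -/
def errorPreimage {m : ℕ} {M : Type*} (e : Fin m → M → ℝ) (V : Set M)
    (A : Set (EuclideanSpace ℝ (Fin m))) : Set M :=
  V ∩ pathError e ⁻¹' A

end

/-! The energy `f = ∑ kᵢ eᵢ²` is a Lyapunov function. Since `⊥_e` is orthogonal to every `grad eᵢ`,
the derivative of `f` along `χ` is `-2‖∑ kᵢ eᵢ grad eᵢ‖²` (`errorEnergyDeriv_eq`). In `V` the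
diffeomorphism `Γ` straightens `e` to a projection, so some tangent vector `Y` satisfies `deᵢ(Y) =
eᵢ` for all `i`; pairing it with `∑ kᵢ eᵢ grad eᵢ` returns `f`, so the derivative is negative in `V`
wherever `f > 0` (`errorEnergyDeriv_neg`).

The sets in question are `V ∩ {f ≤ R}`, `V ∩ {f < R}` and `V ∩ {f = R}`. The first is compact, being
`Γ⁻¹(Ē × S¹)`. A solution cannot leave it: `f` does not increase, and a closed set that is cut out
by `f` inside an open `V` cannot be escaped through the boundary of `V`
(`mem_of_isMIntegralCurveOn`). Compactness then gives existence for all positive times and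
convergence, and strict decrease on `f = R` gives (i) and (iv).

Existence and uniqueness of solutions need `χ` to be `C¹`. For `⊥_e` this comes from writing the
volume form with Gram determinants of a local frame. -/

/-! ### Gram determinants and the volume form. -/

section LinearAlgebra

variable {n : ℕ} {F : Type*} [NormedAddCommGroup F] [InnerProductSpace ℝ F]

/-- In an oriented orthonormal basis both factors are determinants of coordinate matrices, and
Parseval identifies the entries of the product matrix as inner products. -/
theorem Orientation.volumeForm_mul_volumeForm [Fact (Module.finrank ℝ F = n)] (hn : 0 < n)
    (o : Orientation ℝ F (Fin n)) (v w : Fin n → F) :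
    o.volumeForm v * o.volumeForm w = (Matrix.of fun i j ↦ inner ℝ (v i) (w j)).det := by
  set b := o.finOrthonormalBasis hn Fact.out
  rw [o.volumeForm_robust b (o.finOrthonormalBasis_orientation hn Fact.out),
    Module.Basis.det_apply, Module.Basis.det_apply, ← Matrix.det_transpose, ← Matrix.det_mul]
  congr 1
  ext i j
  simp only [Matrix.mul_apply, Matrix.transpose_apply, Module.Basis.toMatrix_apply,
    OrthonormalBasis.coe_toBasis_repr_apply, OrthonormalBasis.repr_apply_apply, Matrix.of_apply]
  rw [← b.sum_inner_mul_inner]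
  exact Finset.sum_congr rfl fun k _ ↦ by rw [real_inner_comm]

theorem Orientation.volumeForm_basis_pos [Fact (Module.finrank ℝ F = n)] (hn : 0 < n)
    {o : Orientation ℝ F (Fin n)} (b : Module.Basis (Fin n) ℝ F) (hb : b.orientation = o) :
    0 < o.volumeForm b := by
  rw [o.volumeForm_robust (o.finOrthonormalBasis hn Fact.out)
    (o.finOrthonormalBasis_orientation hn Fact.out), ← Module.Basis.orientation_eq_iff_det_pos,
    o.finOrthonormalBasis_orientation, hb]

theorem Orientation.volumeForm_basis [Fact (Module.finrank ℝ F = n)] (hn : 0 < n)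
    {o : Orientation ℝ F (Fin n)} (b : Module.Basis (Fin n) ℝ F) (hb : b.orientation = o) :
    o.volumeForm b = √(Matrix.gram ℝ b).det := by
  have h := o.volumeForm_mul_volumeForm hn b b
  rw [show (Matrix.gram ℝ b).det = o.volumeForm b * o.volumeForm b from h.symm,
    Real.sqrt_mul_self (volumeForm_basis_pos hn b hb).le]

/-- The volume form in terms of inner products with a positively oriented basis. -/
theorem Orientation.volumeForm_eq_det_div [Fact (Module.finrank ℝ F = n)] (hn : 0 < n)
    {o : Orientation ℝ F (Fin n)} (b : Module.Basis (Fin n) ℝ F) (hb : b.orientation = o)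
    (v : Fin n → F) :
    o.volumeForm v =
      (Matrix.of fun i j ↦ inner ℝ (v i) (b j)).det / √(Matrix.gram ℝ b).det := by
  rw [← volumeForm_basis hn b hb, ← o.volumeForm_mul_volumeForm hn,
    mul_div_cancel_right₀ _ (volumeForm_basis_pos hn b hb).ne']

theorem Module.Basis.det_gram_pos {ι : Type*} [Fintype ι] [DecidableEq ι]
    (b : Module.Basis ι ℝ F) : 0 < (Matrix.gram ℝ b).det :=
  (Matrix.posDef_gram_of_linearIndependent b.linearIndependent).det_pos

/-- Coordinates in terms of inner products with the basis vectors. -/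
theorem Module.Basis.repr_eq_gram_adjugate {ι : Type*} [Fintype ι] [DecidableEq ι]
    (b : Module.Basis ι ℝ F) (v : F) (i : ι) :
    b.repr v i = (Matrix.gram ℝ b).det⁻¹ *
      ∑ j, (Matrix.gram ℝ b).adjugate i j * inner ℝ (b j) v := by
  have h : (Matrix.gram ℝ b).mulVec (b.repr v) = fun j ↦ inner ℝ (b j) v := by
    ext j
    conv_rhs => rw [← b.sum_repr v, inner_sum]
    simp only [Matrix.mulVec, dotProduct, Matrix.gram_apply, inner_smul_right]
    exact Finset.sum_congr rfl fun k _ ↦ mul_comm _ _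
  -- The adjugate serves as inverse because its entries are polynomials in those of the Gram matrix,
  -- hence as smooth as they are.
  have h2 := congrArg ((Matrix.gram ℝ b).adjugate.mulVec) h
  rw [Matrix.mulVec_mulVec, Matrix.adjugate_mul, Matrix.smul_mulVec, Matrix.one_mulVec] at h2
  have h3 := congrFun h2 i
  rw [Pi.smul_apply, smul_eq_mul] at h3
  rw [eq_inv_mul_iff_mul_eq₀ b.det_gram_pos.ne', h3]
  rfl

end LinearAlgebra

/-! ### Smooth dependence of determinants and adjugates. -/

section Smoothness

variable {E H M : Type*} [NormedAddCommGroup E] [NormedSpace ℝ E] [TopologicalSpace H]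
  {I : ModelWithCorners ℝ E H} [TopologicalSpace M] [ChartedSpace H M] {k : WithTop ℕ∞} {x₀ : M}
  {ι : Type*} [Fintype ι] [DecidableEq ι]

theorem ContMDiffAt.matrix_det {A : M → Matrix ι ι ℝ}
    (hA : ∀ i j, ContMDiffAt I 𝓘(ℝ, ℝ) k (fun x ↦ A x i j) x₀) :
    ContMDiffAt I 𝓘(ℝ, ℝ) k (fun x ↦ (A x).det) x₀ := by
  simp only [Matrix.det_apply']
  exact contMDiffAt_finsetSum fun σ _ ↦
    contMDiffAt_const.mul (contMDiffAt_finsetProd fun i _ ↦ hA _ _)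

theorem ContMDiffAt.matrix_adjugate {A : M → Matrix ι ι ℝ}
    (hA : ∀ i j, ContMDiffAt I 𝓘(ℝ, ℝ) k (fun x ↦ A x i j) x₀) (i j : ι) :
    ContMDiffAt I 𝓘(ℝ, ℝ) k (fun x ↦ (A x).adjugate i j) x₀ := by
  simp only [Matrix.adjugate_apply]
  refine ContMDiffAt.matrix_det fun a b ↦ ?_
  by_cases h : a = j
  · subst h; simpa using contMDiffAt_const
  · simpa [Matrix.updateRow_ne h] using hA a b

end Smoothness

/-! ### `C¹` vector fields and local frames. -/

section VectorFields

variable {n : ℕ} {M : Type*} [TopologicalSpace M] [ChartedSpace (EuclideanSpace ℝ (Fin n)) M]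
  [IsManifold (𝓡 n) ∞ M]

/-- Vector fields of class `C^1`. -/
abbrev IsC1At (X : (x : M) → TangentSpace (𝓡 n) x) (x₀ : M) : Prop :=
  ContMDiffAt (𝓡 n) (𝓡 n).tangent 1 (fun x ↦ (⟨x, X x⟩ : TangentBundle (𝓡 n) M)) x₀

open Classical in
/-- The frame of the tangent bundle near `x₀` induced by a basis of the model space. -/
noncomputable def tangentFrame (b : Module.Basis (Fin n) ℝ (EuclideanSpace ℝ (Fin n))) (x₀ x : M) :
    Module.Basis (Fin n) ℝ (TangentSpace (𝓡 n) x) :=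
  if hx : x ∈ (trivializationAt (EuclideanSpace ℝ (Fin n))
      (TangentSpace (𝓡 n) : M → Type _) x₀).baseSet then
    (trivializationAt (EuclideanSpace ℝ (Fin n))
      (TangentSpace (𝓡 n) : M → Type _) x₀).basisAt b hx
  -- Only points near `x₀` matter; elsewhere any basis of the fibre will do.
  else (trivializationAt (EuclideanSpace ℝ (Fin n))
      (TangentSpace (𝓡 n) : M → Type _) x).basisAt b (FiberBundle.mem_baseSet_trivializationAt' x)

variable (b : Module.Basis (Fin n) ℝ (EuclideanSpace ℝ (Fin n)))

theorem tangentFrame_of_mem {x₀ x : M} (hx : x ∈ (trivializationAt (EuclideanSpace ℝ (Fin n))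
      (TangentSpace (𝓡 n) : M → Type _) x₀).baseSet) :
    tangentFrame b x₀ x = (trivializationAt (EuclideanSpace ℝ (Fin n))
      (TangentSpace (𝓡 n) : M → Type _) x₀).basisAt b hx :=
  dif_pos hx

theorem eventually_mem_tangent_baseSet (x₀ : M) :
    ∀ᶠ x in 𝓝 x₀, x ∈ (trivializationAt (EuclideanSpace ℝ (Fin n))
      (TangentSpace (𝓡 n) : M → Type _) x₀).baseSet :=
  (trivializationAt (EuclideanSpace ℝ (Fin n)) (TangentSpace (𝓡 n) : M → Type _)
    x₀).open_baseSet.mem_nhds (FiberBundle.mem_baseSet_trivializationAt' x₀)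

theorem isC1At_tangentFrame (x₀ : M) (i : Fin n) :
    IsC1At (fun x ↦ tangentFrame b x₀ x i) x₀ := by
  refine (contMDiffAt_localFrame_of_mem (I := 𝓡 n) 1 (trivializationAt (EuclideanSpace ℝ (Fin n))
    (TangentSpace (𝓡 n) : M → Type _) x₀) b i
    (FiberBundle.mem_baseSet_trivializationAt' x₀)).congr_of_eventuallyEq ?_
  filter_upwards [eventually_mem_tangent_baseSet (n := n) x₀] with x hx
  rw [tangentFrame_of_mem b hx, Trivialization.localFrame_apply_of_mem_baseSet _ _ hx]

theorem IsC1At.smul {f : M → ℝ} {X : (x : M) → TangentSpace (𝓡 n) x} {x₀ : M}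
    (hf : ContMDiffAt (𝓡 n) 𝓘(ℝ, ℝ) 1 f x₀) (hX : IsC1At X x₀) :
    IsC1At (fun x ↦ f x • X x) x₀ :=
  ContMDiffAt.smul_section hf hX

theorem IsC1At.sub {X Y : (x : M) → TangentSpace (𝓡 n) x} {x₀ : M}
    (hX : IsC1At X x₀) (hY : IsC1At Y x₀) :
    IsC1At (fun x ↦ X x - Y x) x₀ :=
  ContMDiffAt.sub_section hX hY

theorem IsC1At.sum {ι : Type*} [Fintype ι] {X : ι → (x : M) → TangentSpace (𝓡 n) x} {x₀ : M}
    (hX : ∀ i, IsC1At (X i) x₀) :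
    IsC1At (fun x ↦ ∑ i, X i x) x₀ :=
  ContMDiffAt.sum_section fun i _ ↦ hX i

/-- The tangent map of a `C²` function is `C¹`; compose it with the section `X` and take the fibre
component. -/
theorem contMDiffAt_mfderiv_apply {f : M → ℝ} (hf : ContMDiff (𝓡 n) 𝓘(ℝ, ℝ) 2 f)
    {X : (x : M) → TangentSpace (𝓡 n) x} {x₀ : M} (hX : IsC1At X x₀) :
    ContMDiffAt (𝓡 n) 𝓘(ℝ, ℝ) 1 (fun x ↦ (mfderiv (𝓡 n) 𝓘(ℝ, ℝ) f x (X x) : ℝ)) x₀ := by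
  have h := (hf.contMDiff_tangentMap (m := 1) (by norm_num)).contMDiffAt.comp x₀ hX
  rw [contMDiffAt_totalSpace] at h
  simpa using h.2

/-- In the trivialization at `x₀` the orientation is a constant `o₀` near `x₀`, so a fixed basis of
the model space oriented by `o₀` induces a positively oriented frame. -/
theorem eventually_orientation_tangentFrame
    {o : (x : M) → Orientation ℝ (TangentSpace (𝓡 n) x) (Fin n)} (hn : 0 < n)
    (ho : IsManifoldOrientation o) (x₀ : M) :
    ∃ b : Module.Basis (Fin n) ℝ (EuclideanSpace ℝ (Fin n)),
      ∀ᶠ x in 𝓝 x₀, (tangentFrame b x₀ x).orientation = o x := by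
  obtain ⟨o₀, h⟩ := ho x₀
  have := Fin.pos_iff_nonempty.1 hn
  refine ⟨(EuclideanSpace.basisFun (Fin n) ℝ).toBasis.adjustToOrientation o₀, ?_⟩
  filter_upwards [h, eventually_mem_tangent_baseSet (n := n) x₀] with x hx hmem
  rw [tangentFrame_of_mem _ hmem, Trivialization.basisAt, Module.Basis.orientation_map,
    Module.Basis.orientation_adjustToOrientation, ← hx hmem]
  exact (Orientation.map (Fin n) ((trivializationAt (EuclideanSpace ℝ (Fin n))
    (TangentSpace (𝓡 n) : M → Type _) x₀).continuousLinearEquivAt ℝ x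
      hmem).toLinearEquiv).symm_apply_apply (o x)

end VectorFields

theorem inner_riemGrad {n : ℕ} {M : Type*} [TopologicalSpace M]
    [ChartedSpace (EuclideanSpace ℝ (Fin n)) M]
    [RiemannianBundle (fun x : M ↦ TangentSpace (𝓡 n) x)] (f : M → ℝ) (x : M)
    (Y : TangentSpace (𝓡 n) x) : inner ℝ (riemGrad f x) Y = (mfderiv (𝓡 n) 𝓘(ℝ, ℝ) f x Y : ℝ) :=
  inner_riesz _ _ _

/-! ### Regularity of gradients and of the volume form. -/

section RiemannianVectorFields

variable {n : ℕ} {M : Type*} [TopologicalSpace M] [ChartedSpace (EuclideanSpace ℝ (Fin n)) M]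
  [IsManifold (𝓡 n) ∞ M] [RiemannianBundle (fun x : M ↦ TangentSpace (𝓡 n) x)]
  [IsContMDiffRiemannianBundle (𝓡 n) ∞ (EuclideanSpace ℝ (Fin n))
      (fun x : M ↦ TangentSpace (𝓡 n) x)]
  (b : Module.Basis (Fin n) ℝ (EuclideanSpace ℝ (Fin n)))

theorem IsC1At.innerProduct {X Y : (x : M) → TangentSpace (𝓡 n) x} {x₀ : M} (hX : IsC1At X x₀)
    (hY : IsC1At Y x₀) : ContMDiffAt (𝓡 n) 𝓘(ℝ, ℝ) 1 (fun x ↦ inner ℝ (X x) (Y x)) x₀ := by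
  have : IsContMDiffRiemannianBundle (𝓡 n) 1 (EuclideanSpace ℝ (Fin n))
      (fun x : M ↦ TangentSpace (𝓡 n) x) :=
    IsContMDiffRiemannianBundle.of_le (n := ∞) (mod_cast le_top)
  exact ContMDiffAt.inner_bundle (IB := 𝓡 n) (F := EuclideanSpace ℝ (Fin n)) (b := fun x ↦ x) hX hY

/-- A vector field is `C^1` if its inner products with the vectors of a frame are. -/
theorem IsC1At.of_inner_tangentFrame {X : (x : M) → TangentSpace (𝓡 n) x} {x₀ : M}
    (hX : ∀ i, ContMDiffAt (𝓡 n) 𝓘(ℝ, ℝ) 1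
      (fun x ↦ inner ℝ (tangentFrame b x₀ x i) (X x)) x₀) : IsC1At X x₀ := by
  have hG : ∀ i j, ContMDiffAt (𝓡 n) 𝓘(ℝ, ℝ) 1
      (fun x ↦ Matrix.gram ℝ (tangentFrame b x₀ x) i j) x₀ := fun i j ↦
    (isC1At_tangentFrame b x₀ i).innerProduct (isC1At_tangentFrame b x₀ j)
  have hrepr : ∀ i, ContMDiffAt (𝓡 n) 𝓘(ℝ, ℝ) 1
      (fun x ↦ (tangentFrame b x₀ x).repr (X x) i) x₀ := fun i ↦ by
    simp only [Module.Basis.repr_eq_gram_adjugate]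
    exact ((ContMDiffAt.matrix_det hG).inv₀ (tangentFrame b x₀ x₀).det_gram_pos.ne').mul
      (contMDiffAt_finsetSum fun j _ ↦ (ContMDiffAt.matrix_adjugate hG i j).mul (hX j))
  have := IsC1At.sum fun i ↦ IsC1At.smul (hrepr i) (isC1At_tangentFrame b x₀ i)
  simpa only [Module.Basis.sum_repr] using this

/-- In a positively oriented frame the volume form is a determinant of inner products divided by the
root of a positive Gram determinant, so no orthonormal frame has to be constructed. -/
theorem ContMDiffAt.volumeForm
    {o : (x : M) → Orientation ℝ (TangentSpace (𝓡 n) x) (Fin n)} (hn : 0 < n)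
    (ho : IsManifoldOrientation o) {X : Fin n → (x : M) → TangentSpace (𝓡 n) x} {x₀ : M}
    (hX : ∀ i, IsC1At (X i) x₀) :
    ContMDiffAt (𝓡 n) 𝓘(ℝ, ℝ) 1 (fun x ↦ (o x).volumeForm (fun i ↦ X i x)) x₀ := by
  obtain ⟨b, hb⟩ := eventually_orientation_tangentFrame hn ho x₀
  have h1 : ContMDiffAt (𝓡 n) 𝓘(ℝ, ℝ) 1 (fun x ↦ (Matrix.gram ℝ (tangentFrame b x₀ x)).det) x₀ :=
    ContMDiffAt.matrix_det fun i j ↦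
      (isC1At_tangentFrame b x₀ i).innerProduct (isC1At_tangentFrame b x₀ j)
  have hpos := (tangentFrame b x₀ x₀).det_gram_pos
  have h2 : ContMDiffAt (𝓡 n) 𝓘(ℝ, ℝ) 1
      (fun x ↦ √(Matrix.gram ℝ (tangentFrame b x₀ x)).det) x₀ :=
    (Real.contDiffAt_sqrt hpos.ne').contMDiffAt.comp x₀ h1
  have h3 : ContMDiffAt (𝓡 n) 𝓘(ℝ, ℝ) 1
      (fun x ↦ (Matrix.of fun i j ↦ inner ℝ (X i x) (tangentFrame b x₀ x j)).det) x₀ :=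
    ContMDiffAt.matrix_det fun i j ↦ (hX i).innerProduct (isC1At_tangentFrame b x₀ j)
  refine (h3.div₀ h2 (Real.sqrt_pos.2 hpos).ne').congr_of_eventuallyEq ?_
  filter_upwards [hb] with x hx
  exact Orientation.volumeForm_eq_det_div hn _ hx _

theorem isC1At_riemGrad {f : M → ℝ} (hf : ContMDiff (𝓡 n) 𝓘(ℝ, ℝ) 2 f) (x₀ : M) :
    IsC1At (riemGrad (n := n) f) x₀ := by
  refine IsC1At.of_inner_tangentFrame (M := M) (EuclideanSpace.basisFun (Fin n) ℝ).toBasis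
    fun i ↦ ?_
  simp_rw [fun x : M ↦ real_inner_comm (riemGrad (n := n) f x), inner_riemGrad]
  exact contMDiffAt_mfderiv_apply hf (isC1At_tangentFrame _ x₀ i)

end RiemannianVectorFields

/-! ### The guiding field is `C¹`. -/

section Guiding

variable {m : ℕ} {M : Type*} [TopologicalSpace M]
  [ChartedSpace (EuclideanSpace ℝ (Fin (m + 1))) M]
  [IsManifold (𝓡 (m + 1)) ∞ M] [RiemannianBundle (fun x : M ↦ TangentSpace (𝓡 (m + 1)) x)]
  [IsContMDiffRiemannianBundle (𝓡 (m + 1)) ∞ (EuclideanSpace ℝ (Fin (m + 1)))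
      (fun x : M ↦ TangentSpace (𝓡 (m + 1)) x)]
  {o : (x : M) → Orientation ℝ (TangentSpace (𝓡 (m + 1)) x) (Fin (m + 1))}
  {e : Fin m → M → ℝ}

theorem isC1At_wedgeGrad (ho : IsManifoldOrientation o)
    (he : ∀ i, ContMDiff (𝓡 (m + 1)) 𝓘(ℝ, ℝ) 2 (e i)) (x₀ : M) : IsC1At (wedgeGrad o e) x₀ := by
  refine IsC1At.of_inner_tangentFrame (M := M) (EuclideanSpace.basisFun (Fin (m + 1)) ℝ).toBasis
    fun i ↦ ?_
  simp_rw [fun x : M ↦ real_inner_comm (wedgeGrad o e x), inner_wedgeGrad]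
  -- The pairing of `⊥_e` with a frame vector is the volume form with that vector in the last slot.
  have := ContMDiffAt.volumeForm m.succ_pos ho (x₀ := x₀)
    (X := Fin.snoc (α := fun _ ↦ (x : M) → TangentSpace (𝓡 (m + 1)) x) (fun j ↦ riemGrad (e j))
      (fun x ↦ tangentFrame (EuclideanSpace.basisFun (Fin (m + 1)) ℝ).toBasis x₀ x i))
    (fun j ↦ by
      refine Fin.lastCases ?_ (fun j ↦ ?_) j
      · simpa only [Fin.snoc_last] using isC1At_tangentFrame _ x₀ i
      · simpa only [Fin.snoc_castSucc] using isC1At_riemGrad (he j) x₀)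
  convert this using 3 with x
  ext j
  refine Fin.lastCases ?_ (fun j ↦ ?_) j <;> simp

theorem contMDiff_guidingField (ho : IsManifoldOrientation o)
    (he : ∀ i, ContMDiff (𝓡 (m + 1)) 𝓘(ℝ, ℝ) 2 (e i)) (k : Fin m → ℝ) :
    ContMDiff (𝓡 (m + 1)) (𝓡 (m + 1)).tangent 1
      (fun x ↦ (⟨x, guidingField o e k x⟩ : TangentBundle (𝓡 (m + 1)) M)) := fun x₀ ↦
  IsC1At.sub (isC1At_wedgeGrad ho he x₀) <| IsC1At.sum fun i ↦
    IsC1At.smul (contMDiffAt_const.mul ((he i).contMDiffAt.of_le one_le_two))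
      (isC1At_riemGrad (he i) x₀)

end Guiding

/-! ### Uniform local existence and continuation of solutions. -/

section IntegralCurves

variable {E H M : Type*} [NormedAddCommGroup E] [NormedSpace ℝ E] [TopologicalSpace H]
  {I : ModelWithCorners ℝ E H} [TopologicalSpace M] [ChartedSpace H M] [IsManifold I 1 M]
  {v : (x : M) → TangentSpace I x}

/-- Local integral curves exist on a time interval that is uniform for nearby initial points. -/
theorem exists_pos_eventually_isMIntegralCurveOn [CompleteSpace E] [BoundarylessManifold I M]
    {x₀ : M} (hv : ContMDiffAt I I.tangent 1 (fun x ↦ (⟨x, v x⟩ : TangentBundle I M)) x₀) :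
    ∃ ε > 0, ∀ᶠ x in 𝓝 x₀, ∃ γ : ℝ → M, γ 0 = x ∧ IsMIntegralCurveOn γ v (Ioo (-ε) ε) := by
  have hx : I.IsInteriorPoint x₀ := BoundarylessManifold.isInteriorPoint
  rw [contMDiffAt_iff] at hv
  obtain ⟨ε, hε, a, r, L, K, hr, hpl⟩ := IsPicardLindelof.of_contDiffAt_one
    (hv.2.contDiffAt (range_mem_nhds_isInteriorPoint hx)).snd
  obtain ⟨α, hα, hcont⟩ :=
    (hpl 0).exists_forall_mem_closedBall_eq_hasDerivWithinAt_continuousOn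
  set y₀ := extChartAt I x₀ x₀
  have hball : Metric.closedBall y₀ (r : ℝ) ∈ 𝓝 y₀ := Metric.closedBall_mem_nhds _ hr
  have hicc : Icc (0 - ε) (0 + ε) ∈ 𝓝 (0 : ℝ) := Icc_mem_nhds (by linarith) (by linarith)
  -- Joint continuity in the initial value and time keeps all nearby solutions inside the chart
  -- target for a common time `δ`.
  have hc := hcont.continuousAt (x := (y₀, (0 : ℝ))) (prod_mem_nhds hball hicc)
  have h0 : α (y₀, 0) = y₀ := (hα y₀ (mem_of_mem_nhds hball)).1
  have hO : interior (extChartAt I x₀).target ∈ 𝓝 (α (y₀, 0)) := by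
    rw [h0]
    exact isOpen_interior.mem_nhds ((I.isInteriorPoint_iff).mp hx)
  have hev := hc.preimage_mem_nhds hO
  rw [nhds_prod_eq, mem_prod_iff] at hev
  obtain ⟨A, hA, B, hB, hAB⟩ := hev
  obtain ⟨δ, hδ, hδB⟩ := Metric.mem_nhds_iff.1 (inter_mem hB hicc)
  rw [Real.ball_eq_Ioo, zero_sub, zero_add] at hδB
  refine ⟨δ, hδ, ?_⟩
  filter_upwards [(continuousAt_extChartAt (I := I) x₀).preimage_mem_nhds (inter_mem hA hball),
    extChartAt_source_mem_nhds (I := I) x₀] with x hxA hxs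
  obtain ⟨hx0, hxd⟩ := hα _ hxA.2
  refine ⟨(extChartAt I x₀).symm ∘ fun t ↦ α (extChartAt I x₀ x, t), ?_, ?_⟩
  · rw [Function.comp_apply, hx0, PartialEquiv.left_inv _ hxs]
  intro t ht
  set f := fun t ↦ α (extChartAt I x₀ x, t)
  have htI : Icc (0 - ε) (0 + ε) ∈ 𝓝 t :=
    mem_of_superset (Ioo_mem_nhds ht.1 ht.2) fun s hs ↦ (hδB hs).2
  have hf := (hxd t (hδB ht).2).hasDerivAt htI
  let xₜ : M := (extChartAt I x₀).symm (f t)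
  have h : HasDerivAt f (x := t) <| fderivWithin ℝ (extChartAt I x₀ ∘ (extChartAt I xₜ).symm)
    (range I) (extChartAt I xₜ xₜ) (v xₜ) := hf
  rw [← tangentCoordChange_def] at h
  have hf3 : f t ∈ interior (extChartAt I x₀).target := hAB (mk_mem_prod hxA.1 (hδB ht).1)
  have hf3' := mem_of_mem_of_subset hf3 interior_subset
  have hft1 := mem_preimage.mp <|
    mem_of_mem_of_subset hf3' (extChartAt I x₀).target_subset_preimage_source
  have hft2 := mem_extChartAt_source (I := I) xₜ
  -- The velocity is known in the chart at `x₀`; the cocycle identity for coordinate changes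
  -- converts it to the chart at the current point `xₜ`.
  have hw : ∀ w : E, HasDerivAt f (tangentCoordChange I xₜ x₀ xₜ w) t →
      HasFDerivWithinAt (writtenInExtChartAt 𝓘(ℝ, ℝ) I t ((extChartAt I x₀).symm ∘ f))
        ((1 : ℝ →L[ℝ] ℝ).smulRight w) (range 𝓘(ℝ, ℝ)) (extChartAt 𝓘(ℝ, ℝ) t t) := by
    intro w h
    have hd : HasDerivAt ((extChartAt I xₜ ∘ (extChartAt I x₀).symm) ∘ f) w t := by
      rw [← tangentCoordChange_self (I := I) (x := xₜ) (z := xₜ) (v := w) hft2,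
        ← tangentCoordChange_comp (x := x₀) ⟨⟨hft2, hft1⟩, hft2⟩]
      apply HasFDerivAt.comp_hasDerivAt _ _ h
      apply HasFDerivWithinAt.hasFDerivAt (s := range I) _ <|
        mem_nhds_iff.mpr ⟨interior (extChartAt I x₀).target,
          subset_trans interior_subset (extChartAt_target_subset_range ..),
          isOpen_interior, hf3⟩
      rw [← (extChartAt I x₀).right_inv hf3']
      exact hasFDerivWithinAt_tangentCoordChange ⟨hft1, hft2⟩
    simpa [writtenInExtChartAt, Function.comp_assoc] using! hd.hasFDerivAt
  exact HasMFDerivAt.hasMFDerivWithinAt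
    ⟨(continuousAt_extChartAt_symm'' hf3').comp h.continuousAt, hw (v xₜ) h⟩

/-- A common existence time passes to subsets and, by taking minima, to finite unions, and it exists
locally; compact induction finishes. -/
theorem IsCompact.exists_pos_forall_isMIntegralCurveOn [CompleteSpace E] [BoundarylessManifold I M]
    (hv : ContMDiff I I.tangent 1 (fun x ↦ (⟨x, v x⟩ : TangentBundle I M))) {K : Set M}
    (hK : IsCompact K) :
    ∃ ε > 0, ∀ x ∈ K, ∃ γ : ℝ → M, γ 0 = x ∧ IsMIntegralCurveOn γ v (Ioo (-ε) ε) := by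
  refine hK.induction_on (p := fun S ↦
    ∃ ε > 0, ∀ x ∈ S, ∃ γ : ℝ → M, γ 0 = x ∧ IsMIntegralCurveOn γ v (Ioo (-ε) ε))
    ⟨1, one_pos, by simp⟩ ?_ ?_ ?_
  · rintro S T hST ⟨ε, hε, h⟩
    exact ⟨ε, hε, fun x hx ↦ h x (hST hx)⟩
  · rintro S T ⟨ε, hε, h⟩ ⟨δ, hδ, h'⟩
    refine ⟨min ε δ, lt_min hε hδ, ?_⟩
    rintro x (hx | hx)
    · obtain ⟨γ, h0, hγ⟩ := h x hx
      exact ⟨γ, h0, hγ.mono (Ioo_subset_Ioo (neg_le_neg (min_le_left _ _)) (min_le_left _ _))⟩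
    · obtain ⟨γ, h0, hγ⟩ := h' x hx
      exact ⟨γ, h0, hγ.mono (Ioo_subset_Ioo (neg_le_neg (min_le_right _ _)) (min_le_right _ _))⟩
  · intro x _
    obtain ⟨ε, hε, h⟩ := exists_pos_eventually_isMIntegralCurveOn (hv x)
    exact ⟨_, mem_nhdsWithin_of_mem_nhds h, ε, hε, fun y hy ↦ hy⟩

variable [T2Space M] [BoundarylessManifold I M]

/-- Solutions starting in a compact forward invariant set exist for all positive times. -/
theorem IsCompact.exists_isMIntegralCurveOn_Ioi [CompleteSpace E]
    (hv : ContMDiff I I.tangent 1 (fun x ↦ (⟨x, v x⟩ : TangentBundle I M))) {K : Set M}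
    (hK : IsCompact K)
    (hinv : ∀ (γ : ℝ → M) (a b : ℝ), 0 ∈ Ioo a b → IsMIntegralCurveOn γ v (Ioo a b) → γ 0 ∈ K →
      ∀ t ∈ Ico 0 b, γ t ∈ K) {x : M} (hx : x ∈ K) :
    ∃ ε > 0, ∃ γ : ℝ → M, γ 0 = x ∧ IsMIntegralCurveOn γ v (Ioi (-ε)) := by
  obtain ⟨ε, hε, hloc⟩ := hK.exists_pos_forall_isMIntegralCurveOn hv
  have key : ∀ N : ℕ, ∃ γ : ℝ → M, γ 0 = x ∧
      IsMIntegralCurveOn γ v (Ioo (-ε) (ε + N * (ε / 2))) := by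
    intro N
    induction N with
    | zero => simpa using hloc x hx
    | succ N ih =>
      obtain ⟨γ, h0, hγ⟩ := ih
      set b := ε + N * (ε / 2) with hb
      have hbε : ε ≤ b := by rw [hb]; have : 0 ≤ (N : ℝ) * (ε / 2) := by positivity
                             linarith
      -- Restarting at `b - ε / 2` gives a piece that overlaps the old solution and reaches `b + ε /
      -- 2`, so each stage gains `ε / 2`.
      have hmem : γ (b - ε / 2) ∈ K :=
        hinv γ (-ε) b ⟨by linarith, by linarith⟩ hγ (h0 ▸ hx) _ ⟨by linarith, by linarith⟩
      obtain ⟨δ, hδ0, hδ⟩ := hloc _ hmem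
      rw [← isMIntegralCurveOn_comp_sub (dt := b - ε / 2)] at hδ
      have hδ' : IsMIntegralCurveOn (δ ∘ (· - (b - ε / 2))) v
          (Ioo (b - ε / 2 - ε) (b + ε / 2)) := by
        refine hδ.mono fun t ht ↦ ?_
        constructor <;> linarith [ht.1, ht.2]
      have := isMIntegralCurveOn_piecewise (t₀ := b - ε / 2) hv hγ hδ'
        ⟨⟨by linarith, by linarith⟩, ⟨by linarith, by linarith⟩⟩ (by simp [hδ0])
      refine ⟨_, ?_, this.mono ?_⟩
      · rw [piecewise, if_pos ⟨by linarith, by linarith⟩, h0]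
      · intro t ht
        push_cast at ht
        by_cases htb : t < b
        · exact Or.inl ⟨ht.1, htb⟩
        · exact Or.inr ⟨by linarith, by linarith [ht.2]⟩
  choose γ h0 hγ using key
  have hN : ∀ t : ℝ, ∃ N : ℕ, t < ε + N * (ε / 2) := fun t ↦ by
    obtain ⟨N, hN⟩ := exists_nat_gt (t / (ε / 2))
    rw [div_lt_iff₀ (by positivity)] at hN
    exact ⟨N, by linarith⟩
  have hle : ∀ {N N' : ℕ}, N ≤ N' → ε + N * (ε / 2) ≤ ε + N' * (ε / 2) := fun h ↦ by gcongr
  have h0mem : ∀ N : ℕ, (0 : ℝ) ∈ Ioo (-ε) (ε + N * (ε / 2)) := fun N ↦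
    ⟨by linarith, by positivity⟩
  have heq : ∀ {N N' : ℕ}, N ≤ N' → EqOn (γ N) (γ N') (Ioo (-ε) (ε + N * (ε / 2))) := fun h ↦
    isMIntegralCurveOn_Ioo_eqOn_of_contMDiff_boundaryless (h0mem _) hv (hγ _)
      ((hγ _).mono (Ioo_subset_Ioo le_rfl (hle h))) (by rw [h0, h0])
  choose N hN using hN
  -- By uniqueness the stages agree where they overlap, so the choice of stage `N t` does not affect
  -- the glued curve.
  have heq' : ∀ (n : ℕ) (t : ℝ), t ∈ Ioo (-ε) (ε + n * (ε / 2)) → γ (N t) t = γ n t := by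
    intro n t ht
    rcases le_total (N t) n with h | h
    · exact heq h ⟨ht.1, hN t⟩
    · exact (heq h ht).symm
  refine ⟨ε, hε, fun t ↦ γ (N t) t, h0 _, fun t ht ↦ ?_⟩
  have hmem : Ioo (-ε) (ε + N t * (ε / 2)) ∈ 𝓝 t := Ioo_mem_nhds ht (hN t)
  refine HasMFDerivAt.hasMFDerivWithinAt ?_
  refine ((hγ (N t) t ⟨ht, hN t⟩).hasMFDerivAt hmem).congr_of_eventuallyEq ?_
  filter_upwards [hmem] with s hs using heq' _ s hs

end IntegralCurves

/-! ### Lyapunov functions: invariance, convergence and exit sets. -/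

section Lyapunov

variable {n : ℕ} {M : Type*} [EMetricSpace M] [ChartedSpace (EuclideanSpace ℝ (Fin n)) M]

/-- `f` is nonincreasing along the flow of `X`, with derivative `g`. -/
structure IsLyapunovFunction (X : (x : M) → TangentSpace (𝓡 n) x) (f g : M → ℝ) : Prop where
  continuous : Continuous f
  continuous_deriv : Continuous g
  deriv_nonpos : ∀ x, g x ≤ 0
  hasDerivWithinAt : ∀ {γ : ℝ → M} {s : Set ℝ}, IsMIntegralCurveOn γ X s → ∀ t ∈ s,
    HasDerivWithinAt (f ∘ γ) (g (γ t)) s t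

namespace IsLyapunovFunction

variable {X : (x : M) → TangentSpace (𝓡 n) x} {f g : M → ℝ} {γ : ℝ → M} {s : Set ℝ}
  {V P : Set M} {R : ℝ}

theorem antitoneOn (h : IsLyapunovFunction X f g) (hs : Convex ℝ s)
    (hγ : IsMIntegralCurveOn γ X s) : AntitoneOn (f ∘ γ) s :=
  antitoneOn_of_hasDerivWithinAt_nonpos hs
    (fun t ht ↦ (h.hasDerivWithinAt hγ t ht).continuousWithinAt)
    (fun t ht ↦ (h.hasDerivWithinAt hγ t (interior_subset ht)).mono interior_subset)
    fun _ _ ↦ h.deriv_nonpos _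

/-- Without a strict drop, monotonicity makes `f ∘ γ` constant on `[0, t]`, so its one-sided
derivative at `0` would vanish. Negativity of `g` is needed only at the starting point. -/
theorem apply_lt_of_deriv_neg (h : IsLyapunovFunction X f g) (hs : Convex ℝ s)
    (hγ : IsMIntegralCurveOn γ X s) (h0 : 0 ∈ s) {t : ℝ} (ht : t ∈ s) (ht0 : 0 < t)
    (hg : g (γ 0) < 0) : f (γ t) < f (γ 0) := by
  by_contra! hle
  have hsub : Icc 0 t ⊆ s := hs.ordConnected.out h0 ht
  have hmem : (0 : ℝ) ∈ Icc 0 t := left_mem_Icc.2 ht0.le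
  have hconst : ∀ r ∈ Icc 0 t, (f ∘ γ) r = f (γ 0) := fun r hr ↦
    le_antisymm (h.antitoneOn hs hγ h0 (hsub hr) hr.1)
      (hle.trans (h.antitoneOn hs hγ (hsub hr) ht hr.2))
  have h1 := (h.hasDerivWithinAt hγ 0 h0).mono hsub
  have h2 : HasDerivWithinAt (f ∘ γ) 0 (Icc 0 t) 0 :=
    (hasDerivWithinAt_const 0 _ (f (γ 0))).congr hconst rfl
  exact hg.ne (UniqueDiffWithinAt.eq_deriv _ (uniqueDiffOn_Icc ht0 0 hmem) h1 h2)

/-- The times spent in the set form a closed set, because the set is closed, and one open to the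
right, because `V` is open and `f` cannot increase. Such a subset of `[0, t]` containing `0` is
everything. -/
theorem mem_of_isMIntegralCurveOn (h : IsLyapunovFunction X f g) (hV : IsOpen V)
    (hK : IsClosed (V ∩ {x | f x ≤ R})) (hs : Convex ℝ s) (hγ : IsMIntegralCurveOn γ X s)
    (h0 : 0 ∈ s) (hγ0 : γ 0 ∈ V ∩ {x | f x ≤ R}) {t : ℝ} (ht : t ∈ s) (ht0 : 0 ≤ t) :
    γ t ∈ V ∩ {x | f x ≤ R} := by
  have hsub : Icc 0 t ⊆ s := hs.ordConnected.out h0 ht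
  have hc : ContinuousOn γ (Icc 0 t) := hγ.continuousOn.mono hsub
  have hcl : IsClosed (γ ⁻¹' (V ∩ {x | f x ≤ R}) ∩ Icc 0 t) := by
    rw [inter_comm]
    exact hc.preimage_isClosed_of_isClosed isClosed_Icc hK
  refine hcl.Icc_subset_of_forall_mem_nhdsWithin hγ0 (fun r hr ↦ ?_) (right_mem_Icc.2 ht0)
  have hr' : r ∈ Icc 0 t := Ico_subset_Icc_self hr.2
  have h1 : γ ⁻¹' V ∈ 𝓝[Ioc r t] r :=
    nhdsWithin_mono r (show Ioc r t ⊆ Icc 0 t from fun y hy ↦ ⟨hr'.1.trans hy.1.le, hy.2⟩)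
      ((hc r hr').preimage_mem_nhdsWithin (hV.mem_nhds hr.1.1))
  rw [nhdsWithin_Ioc_eq_nhdsGT hr.2.2] at h1
  filter_upwards [h1, Ioc_mem_nhdsGT hr.2.2] with y hy hyt
  have hy' : y ∈ Icc 0 t := ⟨hr'.1.trans hyt.1.le, hyt.2⟩
  exact ⟨hy, (h.antitoneOn hs hγ h0 (hsub hy') hy'.1).trans hγ0.2⟩

/-- If `f` stayed at least `δ`, compactness would bound `g` above by a negative constant along the
curve, and `f` would decrease at least linearly. -/
theorem eventually_lt (h : IsLyapunovFunction X f g) {K : Set M} (hK : IsCompact K)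
    (hγ : IsMIntegralCurveOn γ X (Ici 0)) (hγK : ∀ t ≥ 0, γ t ∈ K)
    (hg : ∀ x ∈ K, 0 < f x → g x < 0) {δ : ℝ} (hδ : 0 < δ) : ∀ᶠ t in atTop, f (γ t) < δ := by
  have hanti := h.antitoneOn (convex_Ici 0) hγ
  by_contra hcon
  have hge : ∀ t ≥ 0, δ ≤ f (γ t) := by
    intro t ht
    by_contra! hlt
    exact hcon ((eventually_ge_atTop t).mono fun r hr ↦
      (hanti ht (ht.le.trans hr : (0 : ℝ) ≤ r) hr).trans_lt hlt)
  have hcomp : IsCompact (K ∩ {x | δ ≤ f x}) :=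
    hK.inter_right (isClosed_le continuous_const h.continuous)
  obtain ⟨z, hz, hmax⟩ := hcomp.exists_isMaxOn ⟨γ 0, hγK 0 le_rfl, hge 0 le_rfl⟩
    h.continuous_deriv.continuousOn
  have hz0 := hg z hz.1 (hδ.trans_le hz.2)
  have hderiv : ∀ t ∈ interior (Ici (0 : ℝ)), HasDerivAt (f ∘ γ) (g (γ t)) t := fun t ht ↦
    (h.hasDerivWithinAt hγ t (interior_subset ht)).hasDerivAt (mem_interior_iff_mem_nhds.1 ht)
  have hbound := (convex_Ici (0 : ℝ)).image_sub_le_mul_sub_of_deriv_le (f := f ∘ γ) (C := g z)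
    (fun t ht ↦ (h.hasDerivWithinAt hγ t ht).continuousWithinAt)
    (fun t ht ↦ (hderiv t ht).differentiableAt.differentiableWithinAt)
    (fun t ht ↦ by
      rw [(hderiv t ht).deriv]
      have ht' : 0 ≤ t := interior_subset (s := Ici (0 : ℝ)) ht
      exact hmax ⟨hγK t ht', hge t ht'⟩)
  -- The time at which the linear upper bound for `f` reaches `0`.
  set T := f (γ 0) / -g z
  have hT : 0 ≤ T := div_nonneg (hδ.le.trans (hge 0 le_rfl)) (by linarith)
  have h1 := hbound 0 self_mem_Ici T hT hT
  have h2 : g z * (T - 0) = -f (γ 0) := by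
    simp only [T, sub_zero]
    field_simp [hz0.ne]
  have h3 := hge T hT
  simp only [Function.comp_apply, h2] at h1
  linarith

/-- On the compact part of `K` at distance at least `ε` from `P`, `f` has a positive minimum; once
`f` falls below it the curve is within `ε` of `P`. -/
theorem tendsto_infEDist (h : IsLyapunovFunction X f g) {K : Set M} (hK : IsCompact K)
    (hγ : IsMIntegralCurveOn γ X (Ici 0)) (hγK : ∀ t ≥ 0, γ t ∈ K)
    (hg : ∀ x ∈ K, 0 < f x → g x < 0) (hP : ∀ x, x ∉ P → 0 < f x) :
    Tendsto (fun t ↦ Metric.infEDist (γ t) P) atTop (𝓝 0) := by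
  rw [ENNReal.tendsto_nhds_zero]
  intro ε hε
  have hcomp : IsCompact (K ∩ {x | ε ≤ Metric.infEDist x P}) :=
    hK.inter_right (isClosed_le continuous_const Metric.continuous_infEDist)
  rcases (K ∩ {x | ε ≤ Metric.infEDist x P}).eq_empty_or_nonempty with hemp | hne
  · filter_upwards [eventually_ge_atTop 0] with t ht
    by_contra! hlt
    exact eq_empty_iff_forall_notMem.1 hemp (γ t) ⟨hγK t ht, hlt.le⟩
  · obtain ⟨z, hz, hmin⟩ := hcomp.exists_isMinOn hne h.continuous.continuousOn
    have hz0 : 0 < f z := hP z fun hzP ↦ by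
      have := hz.2
      rw [mem_ofPred_eq, Metric.infEDist_zero_of_mem hzP] at this
      exact hε.not_ge this
    filter_upwards [h.eventually_lt hK hγ hγK hg hz0, eventually_ge_atTop 0] with t ht ht0
    by_contra! hlt
    exact ht.not_ge (hmin ⟨hγK t ht0, hlt.le⟩)

theorem flowImage_subset (h : IsLyapunovFunction X f g) (hV : IsOpen V)
    (hK : IsClosed (V ∩ {x | f x ≤ R})) (hg : ∀ x ∈ V, f x = R → g x < 0) :
    flowImage X (Ioi 0) (V ∩ {x | f x = R}) ⊆ V ∩ {x | f x < R} := by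
  rintro y ⟨t, ht, x, hx, γ, a, b, h0, htab, hγ, rfl, rfl⟩
  refine ⟨(h.mem_of_isMIntegralCurveOn hV hK (convex_Ioo a b) hγ h0 ⟨hx.1, hx.2.le⟩ htab
    (le_of_lt ht)).1, ?_⟩
  exact (h.apply_lt_of_deriv_neg (convex_Ioo a b) hγ h0 htab ht (hg _ hx.1 hx.2)).trans_eq hx.2

variable [IsManifold (𝓡 n) ∞ M]

theorem flowForwardInvariant (h : IsLyapunovFunction X f g)
    (hX : ContMDiff (𝓡 n) (𝓡 n).tangent 1 (fun x ↦ (⟨x, X x⟩ : TangentBundle (𝓡 n) M)))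
    (hV : IsOpen V) (hK : IsCompact (V ∩ {x | f x ≤ R})) :
    FlowForwardInvariant X (V ∩ {x | f x ≤ R}) ∧ FlowForwardInvariant X (V ∩ {x | f x < R}) := by
  have hex : ∀ x ∈ V ∩ {x | f x ≤ R}, ∀ t ≥ 0, ∃ y, FlowsTo X t x y := by
    intro x hx t ht
    obtain ⟨ε, hε, γ, h0, hγ⟩ := hK.exists_isMIntegralCurveOn_Ioi hX
      (fun γ a b hab hγ hγ0 t ht ↦ h.mem_of_isMIntegralCurveOn hV hK.isClosed (convex_Ioo a b) hγ
        hab hγ0 ⟨hab.1.trans_le ht.1, ht.2⟩ ht.1) hx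
    exact ⟨γ t, γ, -ε, t + 1, ⟨by linarith, by linarith⟩, ⟨by linarith, by linarith⟩,
      hγ.mono Ioo_subset_Ioi_self, h0, rfl⟩
  have hmem : ∀ x ∈ V ∩ {x | f x ≤ R}, ∀ t ≥ 0, ∀ y, FlowsTo X t x y →
      y ∈ V ∩ {x | f x ≤ R} ∧ f y ≤ f x := by
    rintro x hx t ht y ⟨γ, a, b, h0, htab, hγ, rfl, rfl⟩
    exact ⟨h.mem_of_isMIntegralCurveOn hV hK.isClosed (convex_Ioo a b) hγ h0 hx htab ht,
      h.antitoneOn (convex_Ioo a b) hγ h0 htab ht⟩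
  refine ⟨fun x hx t ht ↦ ⟨hex x hx t ht, fun y hy ↦ (hmem x hx t ht y hy).1⟩, fun x hx t ht ↦ ?_⟩
  have hx' : x ∈ V ∩ {x | f x ≤ R} := ⟨hx.1, (show f x < R from hx.2).le⟩
  refine ⟨hex x hx' t ht, fun y hy ↦ ?_⟩
  obtain ⟨h1, h2⟩ := hmem x hx' t ht y hy
  exact ⟨h1.1, h2.trans_lt hx.2⟩

theorem exists_isForwardTrajectory (h : IsLyapunovFunction X f g)
    (hX : ContMDiff (𝓡 n) (𝓡 n).tangent 1 (fun x ↦ (⟨x, X x⟩ : TangentBundle (𝓡 n) M)))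
    (hV : IsOpen V) (hK : IsCompact (V ∩ {x | f x ≤ R})) {x : M} (hx : x ∈ V ∩ {x | f x ≤ R}) :
    ∃ ξ, IsForwardTrajectory X x ξ := by
  obtain ⟨ε, hε, γ, h0, hγ⟩ := hK.exists_isMIntegralCurveOn_Ioi hX
    (fun γ a b hab hγ hγ0 t ht ↦ h.mem_of_isMIntegralCurveOn hV hK.isClosed (convex_Ioo a b) hγ
      hab hγ0 ⟨hab.1.trans_le ht.1, ht.2⟩ ht.1) hx
  exact ⟨γ, h0, hγ.mono (Ici_subset_Ioi.2 (by linarith))⟩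

/-- A point of `W` off the level set lies in the open complement of `V ∩ {f ≤ R}`, so its solution
stays in `W` for a short time. On the level set strict decrease leads out of `W` at arbitrarily
small positive times. -/
theorem exitSet_eq (h : IsLyapunovFunction X f g)
    (hX : ContMDiff (𝓡 n) (𝓡 n).tangent 1 (fun x ↦ (⟨x, X x⟩ : TangentBundle (𝓡 n) M)))
    (hV : IsOpen V) (hK : IsClosed (V ∩ {x | f x ≤ R})) (hg : ∀ x ∈ V, f x = R → g x < 0) :
    exitSet X (V ∩ {x | f x < R})ᶜ = V ∩ {x | f x = R} := by
  ext x
  obtain ⟨γ, h0, hγ'⟩ := exists_isMIntegralCurveAt_of_contMDiffAt_boundaryless (t₀ := 0) (hX x)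
  obtain ⟨ε, hε, hγ⟩ := isMIntegralCurveAt_iff'.1 hγ'
  rw [Real.ball_eq_Ioo, zero_sub, zero_add] at hγ
  constructor
  · rintro ⟨hxW, hexit⟩
    by_contra hxS
    have hxK : x ∈ (V ∩ {x | f x ≤ R})ᶜ := fun hx ↦ by
      rcases lt_or_eq_of_le (show f x ≤ R from hx.2) with hlt | heq
      · exact hxW ⟨hx.1, hlt⟩
      · exact hxS ⟨hx.1, heq⟩
    have hnhds := hγ'.continuousAt.preimage_mem_nhds (h0 ▸ hK.isOpen_compl.mem_nhds hxK)
    obtain ⟨δ, hδ, hδK⟩ := Metric.mem_nhds_iff.1 hnhds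
    rw [Real.ball_eq_Ioo, zero_sub, zero_add] at hδK
    refine hexit (min δ ε) (lt_min hδ hε) ?_
    rintro y ⟨t, ht, _, rfl, γ', a, b, h0', htab, hγ'', h0'', rfl⟩ hy
    have htδ : t < δ := ht.2.trans_le (min_le_left _ _)
    have htε : t < ε := ht.2.trans_le (min_le_right _ _)
    -- The flow relation allows any solution through `x`; uniqueness identifies it with `γ` on the
    -- common interval.
    have heq := isMIntegralCurveOn_Ioo_eqOn_of_contMDiff_boundaryless (t₀ := 0)
      (a := max a (-ε)) (b := min b ε) ⟨max_lt h0'.1 (by linarith), lt_min h0'.2 hε⟩ hX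
      (hγ''.mono (Ioo_subset_Ioo (le_max_left _ _) (min_le_left _ _)))
      (hγ.mono (Ioo_subset_Ioo (le_max_right _ _) (min_le_right _ _))) (h0''.trans h0.symm)
      ⟨max_lt htab.1 (by linarith [ht.1]), lt_min htab.2 htε⟩
    have hmem : γ t ∈ (V ∩ {x | f x ≤ R})ᶜ := hδK ⟨by linarith [ht.1], htδ⟩
    rw [← heq] at hmem
    exact hmem ⟨hy.1, (show f (γ' t) < R from hy.2).le⟩
  · intro hx
    refine ⟨fun hx' ↦ (ne_of_lt hx'.2) hx.2, fun t ht hsub ↦ ?_⟩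
    have hpos : 0 < min (t / 2) (ε / 2) := lt_min (by linarith) (by linarith)
    have hlt : min (t / 2) (ε / 2) < ε := (min_le_right _ _).trans_lt (by linarith)
    have hflow : FlowsTo X (min (t / 2) (ε / 2)) x (γ (min (t / 2) (ε / 2))) :=
      ⟨γ, -ε, ε, ⟨by linarith, hε⟩, ⟨by linarith, hlt⟩, hγ, h0, rfl⟩
    exact hsub ⟨_, ⟨hpos.le, (min_le_left _ _).trans_lt (by linarith)⟩, x, rfl, hflow⟩
      (h.flowImage_subset hV hK hg ⟨_, hpos, x, hx, hflow⟩)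

end IsLyapunovFunction

end Lyapunov

/-! ### Closure, boundary and compactness of the ellipsoid. -/

section Ellipsoid

variable {m : ℕ} {k : Fin m → ℝ} {R : ℝ}

theorem continuous_ellipsoid_form (k : Fin m → ℝ) :
    Continuous fun y : EuclideanSpace ℝ (Fin m) ↦ ∑ i, k i * y i ^ 2 := by
  fun_prop

theorem ellipsoid_form_smul (k : Fin m → ℝ) (c : ℝ) (y : EuclideanSpace ℝ (Fin m)) :
    ∑ i, k i * (c • y) i ^ 2 = c ^ 2 * ∑ i, k i * y i ^ 2 := by
  rw [Finset.mul_sum]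
  exact Finset.sum_congr rfl fun i _ ↦ by simp only [PiLp.smul_apply, smul_eq_mul]; ring

/-- By homogeneity of degree two, scaling a point of the closed sublevel set by `c < 1` moves it
into the open one; let `c` tend to `1`. -/
theorem closure_ellipsoid (hR : 0 < R) :
    closure (ellipsoid k R) = {y | ∑ i, k i * y i ^ 2 ≤ R} := by
  refine subset_antisymm (closure_minimal (fun y hy ↦ (show ∑ i, k i * y i ^ 2 < R from hy).le)
    (isClosed_le (continuous_ellipsoid_form k) continuous_const)) fun y hy ↦ ?_
  have h1 : Tendsto (fun c : ℝ ↦ c • y) (𝓝[<] 1) (𝓝 y) := by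
    have : Continuous fun c : ℝ ↦ c • y := by fun_prop
    simpa using (this.tendsto 1).mono_left nhdsWithin_le_nhds
  refine mem_closure_of_tendsto h1 ?_
  filter_upwards [Ioo_mem_nhdsLT (show (0 : ℝ) < 1 by norm_num)] with c hc
  rw [ellipsoid, mem_ofPred_eq, ellipsoid_form_smul]
  have hc2 : c ^ 2 < 1 := by nlinarith [hc.1, hc.2]
  have hy' : ∑ i, k i * y i ^ 2 ≤ R := hy
  nlinarith [mul_le_mul_of_nonneg_left hy' (sq_nonneg c)]

/-- A point with value exactly `R > 0` is not interior, since scaling by `c > 1` raises the value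
above `R`. -/
theorem frontier_closure_ellipsoid (hR : 0 < R) :
    frontier (closure (ellipsoid k R)) = {y | ∑ i, k i * y i ^ 2 = R} := by
  rw [isClosed_closure.frontier_eq, closure_ellipsoid hR]
  ext y
  constructor
  · rintro ⟨hy, hint⟩
    refine le_antisymm hy (not_lt.1 fun hlt ↦ hint ?_)
    exact interior_maximal (fun z hz ↦ le_of_lt hz)
      (isOpen_lt (continuous_ellipsoid_form k) continuous_const) hlt
  · intro hy
    have hy' : ∑ i, k i * y i ^ 2 = R := hy
    refine ⟨hy'.le, fun hint ↦ ?_⟩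
    have hc : ContinuousAt (fun c : ℝ ↦ c • y) 1 := by fun_prop
    have hev := hc.preimage_mem_nhds (by rw [one_smul]; exact mem_interior_iff_mem_nhds.1 hint)
    obtain ⟨c, hc1, hc2⟩ := (Filter.Eventually.and (f := 𝓝[>] (1 : ℝ)) (nhdsWithin_le_nhds hev)
      self_mem_nhdsWithin).exists
    have : ∑ i, k i * (c • y) i ^ 2 ≤ R := hc1
    rw [ellipsoid_form_smul, hy'] at this
    have hc3 : 1 < c := hc2
    exact this.not_gt (lt_mul_of_one_lt_left hR (one_lt_pow₀ hc3 two_ne_zero))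

theorem isCompact_closure_ellipsoid (hk : ∀ i, 0 < k i) (hR : 0 < R) :
    IsCompact (closure (ellipsoid k R)) := by
  refine Metric.isCompact_of_isClosed_isBounded isClosed_closure ?_
  rw [closure_ellipsoid hR]
  -- Each term satisfies `kᵢ yᵢ² ≤ R`, whence `yᵢ² ≤ R / kᵢ`.
  refine isBounded_iff_forall_norm_le.2 ⟨√(∑ i, R / k i), fun y hy ↦ ?_⟩
  rw [EuclideanSpace.norm_eq]
  refine Real.sqrt_le_sqrt (Finset.sum_le_sum fun i _ ↦ ?_)
  rw [le_div_iff₀ (hk i), Real.norm_eq_abs, sq_abs, mul_comm]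
  exact (Finset.single_le_sum (f := fun i ↦ k i * y i ^ 2)
    (fun j _ ↦ mul_nonneg (hk j).le (sq_nonneg _)) (Finset.mem_univ i)).trans hy

end Ellipsoid

/-- The derivative of `f` at `x` in the direction of the tangent vector `Y`. -/
noncomputable def directionalDeriv {n : ℕ} {M : Type*} [TopologicalSpace M]
    [ChartedSpace (EuclideanSpace ℝ (Fin n)) M] (f : M → ℝ) (x : M)
    (Y : TangentSpace (𝓡 n) x) : ℝ :=
  mfderiv (𝓡 n) 𝓘(ℝ, ℝ) f x Y

/-! ### Consequences of the trivialization `Γ`. -/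

section Trivialization

variable {m : ℕ} {M : Type*} [TopologicalSpace M] [ChartedSpace (EuclideanSpace ℝ (Fin (m + 1))) M]
  {e : Fin m → M → ℝ} {k : Fin m → ℝ} {R : ℝ}
  {V : TopologicalSpace.Opens M} {U : TopologicalSpace.Opens (EuclideanSpace ℝ (Fin m))}
  (Γ : Diffeomorph (𝓡 (m + 1)) ((𝓡 m).prod (𝓡 1)) V (U × Circle) 2)

/-- The preimage is the image of `A × S¹` under `Γ⁻¹`. -/
theorem isCompact_errorPreimage
    (hΓ : ∀ x : V, ((Γ x).1 : EuclideanSpace ℝ (Fin m)) = pathError e (x : M))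
    {A : Set (EuclideanSpace ℝ (Fin m))} (hA : IsCompact A)
    (hAU : A ⊆ U) : IsCompact (errorPreimage e V A) := by
  have h1 : IsCompact ((↑) ⁻¹' A : Set U) :=
    Topology.IsInducing.subtypeVal.isCompact_preimage_iff
      (by rwa [Subtype.range_coe_subtype]) |>.2 hA
  have h2 := (h1.prod (isCompact_univ (X := Circle))).image Γ.symm.continuous
  convert h2.image continuous_subtype_val using 1
  ext x
  constructor
  · rintro ⟨hxV, hx⟩
    refine ⟨⟨x, hxV⟩, ⟨Γ ⟨x, hxV⟩, ⟨?_, mem_univ _⟩, Γ.symm_apply_apply _⟩, rfl⟩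
    rw [mem_preimage, hΓ]
    exact hx
  · rintro ⟨_, ⟨p, hp, rfl⟩, rfl⟩
    refine ⟨(Γ.symm p).2, ?_⟩
    rw [mem_preimage, ← hΓ, Γ.apply_symm_apply]
    exact hp.1

/-- Pull the radial curve `t ↦ ((1 + t) u, θ)` back by `Γ`: along it `e` equals `(1 + t) e(x)`, so
its velocity at `0` is the required `Y`. -/
theorem exists_tangent_mfderiv_eq [IsManifold (𝓡 (m + 1)) ∞ M]
    (hΓ : ∀ x : V, ((Γ x).1 : EuclideanSpace ℝ (Fin m)) = pathError e (x : M))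
    (he : ∀ i, ContMDiff (𝓡 (m + 1)) 𝓘(ℝ, ℝ) 2 (e i)) {x : M} (hx : x ∈ V) :
    ∃ Y : TangentSpace (𝓡 (m + 1)) x, ∀ i, directionalDeriv (e i) x Y = e i x := by
  classical
  set u : U := (Γ ⟨x, hx⟩).1 with hu
  set θ : Circle := (Γ ⟨x, hx⟩).2
  have hcurve : ContDiff ℝ ∞ fun t : ℝ ↦ (1 + t) • (u : EuclideanSpace ℝ (Fin m)) := by fun_prop
  have hev : ∀ᶠ t : ℝ in 𝓝 0, (1 + t) • (u : EuclideanSpace ℝ (Fin m)) ∈ U :=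
    hcurve.continuous.continuousAt.preimage_mem_nhds (by simpa using U.2.mem_nhds u.2)
  -- The default `u` is used only where the radial curve leaves `U`, hence not near `t = 0`.
  let c : ℝ → U := fun t ↦
    if h : (1 + t) • (u : EuclideanSpace ℝ (Fin m)) ∈ U then ⟨_, h⟩ else u
  have hc : ∀ᶠ t in 𝓝 0, (c t : EuclideanSpace ℝ (Fin m)) = (1 + t) • u := by
    filter_upwards [hev] with t ht
    simp only [c, dif_pos ht]
  have hc0 : c 0 = u := Subtype.ext (by simpa using hc.self_of_nhds)
  have hcd : ContMDiffAt 𝓘(ℝ, ℝ) (𝓡 m) ∞ c 0 := by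
    rw [← ContMDiffAt.subtypeVal_comp_iff]
    exact hcurve.contMDiff.contMDiffAt.congr_of_eventuallyEq hc
  let σ : ℝ → M := fun t ↦ (Γ.symm (c t, θ) : V)
  have hσ0 : σ 0 = x := by
    simp only [σ, hc0, hu, θ, Prod.mk.eta, Γ.symm_apply_apply]
  have hσ : ContMDiffAt 𝓘(ℝ, ℝ) (𝓡 (m + 1)) 2 σ 0 :=
    contMDiff_subtype_val.contMDiffAt.comp (0 : ℝ)
      (Γ.symm.contMDiff.contMDiffAt.comp (0 : ℝ)
        ((hcd.of_le ENat.LEInfty.out).prodMk contMDiffAt_const))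
  have hσd := (hσ.mdifferentiableAt two_ne_zero).hasMFDerivAt
  have heσ : ∀ i, (fun t ↦ e i (σ t)) =ᶠ[𝓝 0] fun t ↦ (1 + t) * e i x := by
    intro i
    have hval : ∀ y : V, e i y = ((Γ y).1 : EuclideanSpace ℝ (Fin m)) i := fun y ↦ by
      rw [hΓ]; rfl
    filter_upwards [hc] with t ht
    rw [show e i x = (u : EuclideanSpace ℝ (Fin m)) i from hval ⟨x, hx⟩, hval, Γ.apply_symm_apply,
      ht]
    rfl
  have key : ∃ Y : TangentSpace (𝓡 (m + 1)) (σ 0),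
      ∀ i, directionalDeriv (e i) (σ 0) Y = e i x := by
    refine ⟨mfderiv 𝓘(ℝ, ℝ) (𝓡 (m + 1)) σ 0 (1 : ℝ), fun i ↦ ?_⟩
    have h1 := ((he i).mdifferentiable two_ne_zero (σ 0)).hasMFDerivAt.comp 0 hσd
    have h2 : HasDerivAt (fun t : ℝ ↦ (1 + t) * e i x) (e i x) 0 := by
      simpa using ((hasDerivAt_id (0 : ℝ)).const_add 1).mul_const (e i x)
    have h3 := (h2.congr_of_eventuallyEq (heσ i)).hasFDerivAt.hasMFDerivAt
    exact (DFunLike.congr_fun (hasMFDerivAt_unique h1 h3) (1 : ℝ)).trans (one_smul ℝ (e i x))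
  rwa [hσ0] at key

end Trivialization

/-! ### The energy as a Lyapunov function. -/

section Energy

/-- The energy `∑ᵢ kᵢ eᵢ²` of the path-following error. -/
noncomputable def errorEnergy {m : ℕ} {M : Type*} (e : Fin m → M → ℝ) (k : Fin m → ℝ)
    (x : M) : ℝ :=
  ∑ i, k i * e i x ^ 2

theorem errorEnergy_pos {m : ℕ} {M : Type*} {e : Fin m → M → ℝ} {k : Fin m → ℝ}
    (hk : ∀ i, 0 < k i) {x : M} (hx : x ∉ desiredPath e) :
    0 < errorEnergy e k x := by
  obtain ⟨i, hi⟩ := not_forall.1 hx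
  exact Finset.sum_pos' (fun j _ ↦ mul_nonneg (hk j).le (sq_nonneg _))
    ⟨i, Finset.mem_univ i, mul_pos (hk i) (by positivity)⟩

variable {m : ℕ} {M : Type*} [EMetricSpace M]
  [ChartedSpace (EuclideanSpace ℝ (Fin (m + 1))) M]
  [RiemannianBundle (fun x : M ↦ TangentSpace (𝓡 (m + 1)) x)]

/-- The vector field `∑ᵢ kᵢ eᵢ grad eᵢ`. -/
noncomputable def errorGrad (e : Fin m → M → ℝ) (k : Fin m → ℝ) (x : M) :
    TangentSpace (𝓡 (m + 1)) x :=
  ∑ i, (k i * e i x) • riemGrad (e i) x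

/-- The derivative of the energy along the guiding vector field. -/
noncomputable def errorEnergyDeriv
    (o : (x : M) → Orientation ℝ (TangentSpace (𝓡 (m + 1)) x) (Fin (m + 1)))
    (e : Fin m → M → ℝ) (k : Fin m → ℝ) (x : M) : ℝ :=
  ∑ i, k i * (2 * e i x * directionalDeriv (e i) x (guidingField o e k x))

variable {o : (x : M) → Orientation ℝ (TangentSpace (𝓡 (m + 1)) x) (Fin (m + 1))}
  {e : Fin m → M → ℝ} {k : Fin m → ℝ}

theorem inner_errorGrad (x : M) (Y : TangentSpace (𝓡 (m + 1)) x) :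
    inner ℝ (errorGrad e k x) Y =
      ∑ i, k i * e i x * directionalDeriv (e i) x Y := by
  simp_rw [errorGrad, sum_inner, real_inner_smul_left, inner_riemGrad]
  rfl

/-- The volume form is alternating and `grad eᵢ` occurs twice. -/
theorem inner_wedgeGrad_riemGrad (x : M) (i : Fin m) :
    inner ℝ (wedgeGrad o e x) (riemGrad (e i) x) = 0 := by
  rw [inner_wedgeGrad]
  exact AlternatingMap.map_eq_zero_of_eq _ _ (i := i.castSucc) (j := Fin.last m) (by simp)
    (Fin.castSucc_lt_last i).ne

/-- `errorGrad` is half the gradient of the energy and `χ = ⊥_e - errorGrad`; the part `⊥_e` is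
orthogonal and drops out. -/
theorem errorEnergyDeriv_eq (x : M) :
    errorEnergyDeriv o e k x = -2 * inner ℝ (errorGrad e k x) (errorGrad e k x) := by
  have h1 : errorEnergyDeriv o e k x = 2 * inner ℝ (errorGrad e k x) (guidingField o e k x) := by
    rw [inner_errorGrad, errorEnergyDeriv, Finset.mul_sum]
    exact Finset.sum_congr rfl fun i _ ↦ by ring
  have h2 : inner ℝ (errorGrad e k x) (wedgeGrad o e x) = 0 := by
    rw [real_inner_comm, errorGrad, inner_sum]
    exact Finset.sum_eq_zero fun i _ ↦ by
      rw [real_inner_smul_right, inner_wedgeGrad_riemGrad, mul_zero]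
  rw [h1, show guidingField o e k x = wedgeGrad o e x - errorGrad e k x from rfl, inner_sub_right,
    h2]
  ring

variable [IsManifold (𝓡 (m + 1)) ∞ M]

/-- Pairing `errorGrad` with the radial vector `Y` gives the energy itself, so `errorGrad` cannot
vanish where the energy is positive. -/
theorem errorEnergyDeriv_neg (he : ∀ i, ContMDiff (𝓡 (m + 1)) 𝓘(ℝ, ℝ) 2 (e i))
    {V : TopologicalSpace.Opens M} {U : TopologicalSpace.Opens (EuclideanSpace ℝ (Fin m))}
    (Γ : Diffeomorph (𝓡 (m + 1)) ((𝓡 m).prod (𝓡 1)) V (U × Circle) 2)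
    (hΓ : ∀ x : V, ((Γ x).1 : EuclideanSpace ℝ (Fin m)) = pathError e (x : M))
    {x : M} (hx : x ∈ V) (hpos : 0 < errorEnergy e k x) : errorEnergyDeriv o e k x < 0 := by
  rw [errorEnergyDeriv_eq]
  have hne : errorGrad e k x ≠ 0 := fun h0 ↦ by
    obtain ⟨Y, hY⟩ := exists_tangent_mfderiv_eq Γ hΓ he hx
    have h1 := inner_errorGrad (e := e) (k := k) x Y
    rw [h0, inner_zero_left] at h1
    refine hpos.ne (h1.trans (Finset.sum_congr rfl fun i _ ↦ ?_))
    rw [hY]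
    ring
  have := real_inner_self_pos.2 hne
  linarith

variable [IsContMDiffRiemannianBundle (𝓡 (m + 1)) ∞ (EuclideanSpace ℝ (Fin (m + 1)))
      (fun x : M ↦ TangentSpace (𝓡 (m + 1)) x)]

theorem isLyapunovFunction_errorEnergy (ho : IsManifoldOrientation o)
    (he : ∀ i, ContMDiff (𝓡 (m + 1)) 𝓘(ℝ, ℝ) 2 (e i)) :
    IsLyapunovFunction (guidingField o e k) (errorEnergy e k) (errorEnergyDeriv o e k) where
  continuous := continuous_finsetSum _ fun i _ ↦ continuous_const.mul ((he i).continuous.pow 2)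
  continuous_deriv := continuous_finsetSum _ fun i _ ↦ continuous_const.mul <|
    (continuous_const.mul (he i).continuous).mul <| continuous_iff_continuousAt.2 fun x ↦
      (contMDiffAt_mfderiv_apply (he i) (contMDiff_guidingField ho he k x)).continuousAt
  deriv_nonpos x := by
    rw [errorEnergyDeriv_eq]
    have := real_inner_self_nonneg (x := errorGrad e k x)
    linarith
  hasDerivWithinAt {γ s} hγ t ht := by
    have h1 : ∀ i, HasDerivWithinAt (fun t ↦ e i (γ t))
        (directionalDeriv (e i) (γ t) (guidingField o e k (γ t))) s t := by
      intro i
      have h2 := ((he i).mdifferentiable two_ne_zero (γ t)).hasMFDerivAt.comp_hasMFDerivWithinAt t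
        (hγ t ht)
      have h3 : ∃ L : ℝ →L[ℝ] ℝ, HasFDerivWithinAt (fun t ↦ e i (γ t)) L s t ∧
          L 1 = directionalDeriv (e i) (γ t) ((1 : ℝ) • guidingField o e k (γ t)) :=
        ⟨_, hasMFDerivWithinAt_iff_hasFDerivWithinAt.1 h2, rfl⟩
      obtain ⟨L, hL, hL1⟩ := h3
      refine hL.hasDerivWithinAt.congr_deriv (hL1.trans ?_)
      exact congrArg (directionalDeriv (e i) (γ t)) (one_smul ℝ (guidingField o e k (γ t)))
    have h3 := HasDerivWithinAt.fun_sum (u := Finset.univ) fun i _ ↦ ((h1 i).pow 2).const_mul (k i)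
    refine h3.congr_deriv (Finset.sum_congr rfl fun i _ ↦ ?_)
    simp

end Energy

/-! ### The main theorem. -/

theorem mainTheorem5 {m : ℕ} {M : Type*} [EMetricSpace M]
    [ChartedSpace (EuclideanSpace ℝ (Fin (m + 1))) M] [IsManifold (𝓡 (m + 1)) ∞ M]
    [RiemannianBundle (fun x : M ↦ TangentSpace (𝓡 (m + 1)) x)]
    [IsContMDiffRiemannianBundle (𝓡 (m + 1)) ∞ (EuclideanSpace ℝ (Fin (m + 1)))
      (fun x : M ↦ TangentSpace (𝓡 (m + 1)) x)]
    [IsRiemannianManifold (𝓡 (m + 1)) M]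
    (o : (x : M) → Orientation ℝ (TangentSpace (𝓡 (m + 1)) x) (Fin (m + 1)))
    (ho : IsManifoldOrientation o)
    (e : Fin m → M → ℝ) (he : ∀ i, ContMDiff (𝓡 (m + 1)) 𝓘(ℝ, ℝ) 2 (e i))
    (k : Fin m → ℝ) (hk : ∀ i, 0 < k i)
    -- no singular points on (or arbitrarily near) the desired path
    (hC : singularSet o e k = ∅ ∨
      0 < ⨅ x ∈ singularSet o e k, Metric.infEDist x (desiredPath e))
    -- the desired path is homeomorphic to the unit circle
    (hP : Nonempty (desiredPath e ≃ₜ Circle))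
    -- a `C²` trivialization `Γ : V → U × S¹` of `e` on a neighbourhood `V` of the desired path
    (V : TopologicalSpace.Opens M) (hPV : desiredPath e ⊆ V)
    (U : TopologicalSpace.Opens (EuclideanSpace ℝ (Fin m)))
    (Γ : Diffeomorph (𝓡 (m + 1)) ((𝓡 m).prod (𝓡 1)) V (U × Circle) 2)
    (hΓ : ∀ x : V, ((Γ x).1 : EuclideanSpace ℝ (Fin m)) = pathError e (x : M))
    (R : ℝ) (hR : 0 < R) (hRU : closure (ellipsoid k R) ⊆ U) :
    -- (i) the exit set of `W = M \ e_V⁻¹(E)` is `S = e_V⁻¹(∂Ē)`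
    exitSet (guidingField o e k) (errorPreimage e V (ellipsoid k R))ᶜ =
      errorPreimage e V (frontier (closure (ellipsoid k R))) ∧
    -- (ii) forward invariance
    FlowForwardInvariant (guidingField o e k) (errorPreimage e V (closure (ellipsoid k R))) ∧
    FlowForwardInvariant (guidingField o e k) (errorPreimage e V (ellipsoid k R)) ∧
    -- (iii) convergence to the desired path
    (∀ x ∈ errorPreimage e V (closure (ellipsoid k R)),
      (∃ ξ : ℝ → M, IsForwardTrajectory (guidingField o e k) x ξ) ∧
      ∀ ξ : ℝ → M, IsForwardTrajectory (guidingField o e k) x ξ →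
        Tendsto (fun t ↦ Metric.infEDist (ξ t) (desiredPath e)) atTop (𝓝 0)) ∧
    -- (iv) forward orbits of `S` at positive times lie in `e_V⁻¹(E)`
    flowImage (guidingField o e k) (Ioi 0)
        (errorPreimage e V (frontier (closure (ellipsoid k R)))) ⊆
      errorPreimage e V (ellipsoid k R) := by
  have hL := isLyapunovFunction_errorEnergy (k := k) ho he
  have hX := contMDiff_guidingField ho he k
  -- All three preimages become sublevel or level sets of the energy within `V`, the form used by
  -- the Lyapunov lemmas.
  have hE : errorPreimage e V (ellipsoid k R) = (V : Set M) ∩ {x | errorEnergy e k x < R} := rfl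
  have hEc : errorPreimage e V (closure (ellipsoid k R)) =
      (V : Set M) ∩ {x | errorEnergy e k x ≤ R} := by
    rw [closure_ellipsoid hR]
    rfl
  have hS : errorPreimage e V (frontier (closure (ellipsoid k R))) =
      (V : Set M) ∩ {x | errorEnergy e k x = R} := by
    rw [frontier_closure_ellipsoid hR]
    rfl
  have hK := isCompact_errorPreimage Γ hΓ (isCompact_closure_ellipsoid hk hR) hRU
  have hneg : ∀ x ∈ (V : Set M), 0 < errorEnergy e k x → errorEnergyDeriv o e k x < 0 :=
    fun x hx hpos ↦ errorEnergyDeriv_neg he Γ hΓ hx hpos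
  have hnegR : ∀ x ∈ (V : Set M), errorEnergy e k x = R → errorEnergyDeriv o e k x < 0 :=
    fun x hx hxR ↦ hneg x hx (hxR ▸ hR)
  rw [hE, hS]
  rw [hEc] at hK ⊢
  obtain ⟨hinv, hinv'⟩ := hL.flowForwardInvariant hX V.2 hK
  refine ⟨hL.exitSet_eq hX V.2 hK.isClosed hnegR, hinv, hinv', fun x hx ↦
    ⟨hL.exists_isForwardTrajectory hX V.2 hK hx, ?_⟩, hL.flowImage_subset V.2 hK.isClosed hnegR⟩
  rintro ξ ⟨rfl, hξ⟩
  exact hL.tendsto_infEDist hK hξ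
    (fun t ht ↦ hL.mem_of_isMIntegralCurveOn V.2 hK.isClosed (convex_Ici 0) hξ self_mem_Ici hx
      ht ht)
    (fun x hx ↦ hneg x hx.1) (fun x hx ↦ errorEnergy_pos hk hx)
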